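/- Let $n,m\ge 0$ and let $M$ be a compact smooth $n$-dimensional manifold without boundary. Let $J\subset[0,\infty)$ be an interval with least element $0$, and let $F:M\times J\to\mathbb{R}^{n+m}$ be a smooth mean curvature flow starting from $F_0:M\to\mathbb{R}^{n+m}$: $F$ is smooth on $M\times J$, every $F_t=F(\cdot,t)$, $t\in J$, is an immersion, $F_t|_{t=0}=F_0$, and $$\frac{\partial F}{\partial t}(x,t)=H(x,t)\qquad (x\in M,\ t\in J),$$ where $H(x,t)$ is the mean curvature vector of $F_t$ at $x$; in local coordinates $H=\sum_{i,j}g^{ij}\,P\big(\partial_i\partial_jF_t\big)$, with $(g^{ij})$ the inverse of the induced metric $g_{ij}=\langle\partial_iF_t,\partial_jF_t\rangle$ and $P$ the orthogonal projection onto the normal space of $F_t$. (The time derivative is one-sided at end points of $J$.) Put $\Sigma=F_0(M)$, $\Sigma_t=F_t(M)$, and for $S\subset\mathbb{R}^{n+m}$ let $N_\delta(S)=\{z : d(z,S)<\delta\}$, where $d(z,\emptyset)=\infty$. Then: 1. for every $t\in J$ and every $\delta\ge 0$ with $2nt\le\delta^2$, $$N_{\sqrt{\delta^2-2nt}}(\Sigma_t)\subset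 N_\delta(\Sigma);$$ 2. for every $t\in J$, every point of $\Sigma_t$ has distance at most $\sqrt{2nt}$ from $\Sigma$; and if moreover $n\ge1$ and $t>0$, then $\Sigma_t\subset N_{\sqrt{2nt}}(\Sigma)$. -/

import Mathlib

open scoped Manifold ContDiff

noncomputable section

/-- Euclidean space `ℝᵏ`. -/
abbrev Euc (k : ℕ) : Type := EuclideanSpace ℝ (Fin k)

section Coordinates

variable {n N : ℕ}

/-- The first partial derivative `∂u/∂xⁱ` at `p`. -/
def partialDeriv (u : Euc n → Euc N) (i : Fin n) (p : Euc n) : Euc N :=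
  fderiv ℝ u p (EuclideanSpace.single i 1)

/-- The second partial derivative `∂²u/∂xⁱ∂xʲ` at `p`. -/
def partialDeriv₂ (u : Euc n → Euc N) (i j : Fin n) (p : Euc n) : Euc N :=
  partialDeriv (partialDeriv u j) i p

/-- The matrix `g i j = ⟨∂u/∂xⁱ, ∂u/∂xʲ⟩` of the induced metric at `p`. -/
def inducedMetric (u : Euc n → Euc N) (p : Euc n) : Matrix (Fin n) (Fin n) ℝ :=
  Matrix.of fun i j => inner ℝ (partialDeriv u i p) (partialDeriv u j p)

/-- The projection of `v` to the normal space of the parametrized submanifold `u` at `p`: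
`P v = v - ∑ₖₗ gᵏˡ ⟨v, ∂u/∂xˡ⟩ ∂u/∂xᵏ`, with `gᵏˡ` the inverse of the induced metric. -/
def normalProjection (u : Euc n → Euc N) (p : Euc n) (v : Euc N) : Euc N :=
  v - ∑ k, ∑ l, ((inducedMetric u p)⁻¹ k l * inner ℝ v (partialDeriv u l p)) • partialDeriv u k p

/-- The mean curvature vector, at parameter `p`, of a submanifold parametrized by `u`:
`∑ᵢⱼ gⁱʲ P (∂²u/∂xⁱ∂xʲ)`. -/
def coordMeanCurvature (u : Euc n → Euc N) (p : Euc n) : Euc N :=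
  ∑ i, ∑ j, (inducedMetric u p)⁻¹ i j • normalProjection u p (partialDeriv₂ u i j p)

end Coordinates

section Manifold

variable (n : ℕ) {N : ℕ} {M : Type*} [TopologicalSpace M] [ChartedSpace (Euc n) M]

/-- The mean curvature vector of an immersion `f : M → ℝᴺ` at `x`, computed in the chart at `x`
(for an immersion it does not depend on the chart). -/
def meanCurvatureVector (f : M → Euc N) (x : M) : Euc N :=
  coordMeanCurvature (f ∘ (chartAt (Euc n) x).symm) (chartAt (Euc n) x x)

/-- `F` is a smooth mean curvature flow of immersions `F t : M → ℝᴺ`, `t ∈ J`, starting from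
`F₀`. Here `M` is an `n`-dimensional manifold and `J` is an interval
with least element `0`; at its end points the time derivative is one-sided. -/
structure IsMeanCurvatureFlow (F₀ : M → Euc N) (J : Set ℝ) (F : ℝ → M → Euc N) : Prop where
  smooth : ContMDiffOn ((𝓡 n).prod 𝓘(ℝ, ℝ)) 𝓘(ℝ, Euc N) ∞
    (fun p : M × ℝ => F p.2 p.1) (Set.univ ×ˢ J)
  immersion : ∀ t ∈ J, ∀ x : M, Function.Injective (mfderiv (𝓡 n) 𝓘(ℝ, Euc N) (F t) x)
  initial : F 0 = F₀
  evolution : ∀ t ∈ J, ∀ x : M,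
    HasDerivWithinAt (fun s => F s x) (meanCurvatureVector n (F t) x) J t

end Manifold

end

open Set Filter Topology

/-! Maximum principle for squared distance to a fixed point `p`. Where `‖F_s - p‖²` is minimal on
`M`, its Hessian is nonnegative; tracing with `g⁻¹` gives `⟨H, F_s - p⟩ ≥ -n`
(`neg_le_inner_meanCurvatureVector`). Hence `min_M ‖F_s - p‖² + 2ns` cannot decrease in `s`
(`exists_norm_sq_le`). The inclusions follow by taking `p` near or on `Σ_t`. -/

theorem deriv_deriv_nonneg_of_isLocalMin {f : ℝ → ℝ} {a : ℝ} (h : IsLocalMin f a)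
    (hc : ContinuousAt f a) : 0 ≤ deriv (deriv f) a := by
  by_contra! hneg
  -- A point that is both a local minimum and a local maximum makes `f` locally constant.
  have hmax := isLocalMax_of_deriv_deriv_neg hneg h.deriv_eq_zero hc
  have heq : f =ᶠ[𝓝 a] fun _ => f a := by
    filter_upwards [h, hmax] with y h₁ h₂ using le_antisymm h₂ h₁
  have : deriv (deriv f) a = 0 := by
    rw [heq.deriv.deriv_eq]
    simp
  exact hneg.ne this

/-- Writing `A = SᵀS` turns the sum into values of the form `B` on the rows of `S`. -/
theorem Matrix.PosSemidef.sum_mul_nonneg {ι : Type*} [Fintype ι] [DecidableEq ι]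
    {A : Matrix ι ι ℝ} (hA : A.PosSemidef) {B : ι → ι → ℝ}
    (hB : ∀ ξ : ι → ℝ, 0 ≤ ∑ i, ∑ j, ξ i * ξ j * B i j) : 0 ≤ ∑ i, ∑ j, A i j * B i j := by
  obtain ⟨S, rfl⟩ : ∃ S : Matrix ι ι ℝ, A = S.conjTranspose * S := by
    open scoped MatrixOrder in
    exact CStarAlgebra.nonneg_iff_eq_star_mul_self.mp hA.nonneg
  have : ∑ i, ∑ j, (S.conjTranspose * S) i j * B i j = ∑ k, ∑ i, ∑ j, S k i * S k j * B i j := by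
    simp only [Matrix.mul_apply, Matrix.conjTranspose_apply, star_trivial, Finset.sum_mul]
    exact (Finset.sum_congr rfl fun i _ => Finset.sum_comm).trans Finset.sum_comm
  rw [this]
  exact Finset.sum_nonneg fun k _ => hB (S k)

section Coordinates

variable {n N : ℕ} {v : Euc n → Euc N} {q : Euc n} {p : Euc N}

theorem inner_fderiv_eq_zero_of_isLocalMin (hv : DifferentiableAt ℝ v q)
    (hmin : IsLocalMin (fun y => ‖v y - p‖ ^ 2) q) (ξ : Euc n) :
    inner ℝ (fderiv ℝ v q ξ) (v q - p) = 0 := by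
  have h := DFunLike.congr_fun (hmin.hasFDerivAt_eq_zero (hv.hasFDerivAt.sub_const p).norm_sq) ξ
  rw [real_inner_comm]
  simpa [inner_sub_left] using h

theorem second_variation_nonneg_of_isLocalMin (hv : ContDiffAt ℝ 2 v q)
    (hmin : IsLocalMin (fun y => ‖v y - p‖ ^ 2) q) (ξ : Euc n) :
    0 ≤ inner ℝ (fderiv ℝ (fderiv ℝ v) q ξ ξ) (v q - p) + ‖fderiv ℝ v q ξ‖ ^ 2 := by
  have hl : ∀ s : ℝ, HasDerivAt (fun s : ℝ => q + s • ξ) ξ s := fun s => by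
    simpa using ((hasDerivAt_id s).smul_const ξ).const_add q
  have hl0 : Tendsto (fun s : ℝ => q + s • ξ) (𝓝 0) (𝓝 q) := by
    simpa using (hl 0).continuousAt.tendsto
  have hφ : ∀ᶠ s : ℝ in 𝓝 0, HasDerivAt (fun s : ℝ => ‖v (q + s • ξ) - p‖ ^ 2)
      (2 * inner ℝ (v (q + s • ξ) - p) (fderiv ℝ v (q + s • ξ) ξ)) s := by
    filter_upwards [hl0.eventually (hv.eventually (by simp))] with s hs
    exact (((hs.differentiableAt (by simp)).hasFDerivAt.comp_hasDerivAt s (hl s)).sub_const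
      p).norm_sq
  have hv' : HasDerivAt (fun s : ℝ => v (q + s • ξ) - p) (fderiv ℝ v q ξ) 0 := by
    have h : HasFDerivAt v (fderiv ℝ v q) (q + (0 : ℝ) • ξ) := by
      simpa using (hv.differentiableAt (by simp)).hasFDerivAt
    exact (h.comp_hasDerivAt 0 (hl 0)).sub_const p
  have hd' : HasDerivAt (fun s : ℝ => fderiv ℝ v (q + s • ξ) ξ)
      (fderiv ℝ (fderiv ℝ v) q ξ ξ) 0 := by
    have h : HasFDerivAt (fderiv ℝ v) (fderiv ℝ (fderiv ℝ v) q) (q + (0 : ℝ) • ξ) := by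
      simpa using ((hv.fderiv_right (m := 1) (by norm_num)).differentiableAt
        (by simp)).hasFDerivAt
    have h' := (ContinuousLinearMap.apply ℝ (Euc N) ξ).hasFDerivAt.comp_hasDerivAt (0 : ℝ)
      (h.comp_hasDerivAt 0 (hl 0))
    exact h'
  have hmin' : IsLocalMin (fun s : ℝ => ‖v (q + s • ξ) - p‖ ^ 2) 0 := by
    have := hl0.eventually hmin
    simpa [IsLocalMin, IsMinFilter] using this
  have h2 := deriv_deriv_nonneg_of_isLocalMin hmin' hφ.self_of_nhds.continuousAt
  have heq : deriv (fun s : ℝ => ‖v (q + s • ξ) - p‖ ^ 2) =ᶠ[𝓝 0]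
      fun s => 2 * inner ℝ (v (q + s • ξ) - p) (fderiv ℝ v (q + s • ξ) ξ) :=
    hφ.mono fun s hs => hs.deriv
  rw [heq.deriv_eq, ((hv'.inner ℝ hd').const_mul 2).deriv] at h2
  simp only [zero_smul, add_zero, real_inner_self_eq_norm_sq] at h2
  rw [real_inner_comm]
  linarith

theorem partialDeriv₂_eq (hv : ContDiffAt ℝ 2 v q) (i j : Fin n) :
    partialDeriv₂ v i j q = fderiv ℝ (fderiv ℝ v) q (EuclideanSpace.single i 1)
      (EuclideanSpace.single j 1) := by
  have h := ((hv.fderiv_right (m := 1) (by norm_num)).differentiableAt (by simp)).hasFDerivAt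
  have h' := (ContinuousLinearMap.apply ℝ (Euc N) (EuclideanSpace.single j (1 : ℝ))).hasFDerivAt.comp
    q h
  exact DFunLike.congr_fun h'.fderiv _

theorem sum_smul_single (ξ : Fin n → ℝ) :
    ∑ i, ξ i • EuclideanSpace.single i (1 : ℝ) = WithLp.toLp 2 ξ := by
  ext k
  simp [Finset.sum_apply, Pi.single_apply]

theorem hessian_nonneg_of_isLocalMin (hv : ContDiffAt ℝ 2 v q)
    (hmin : IsLocalMin (fun y => ‖v y - p‖ ^ 2) q) (ξ : Fin n → ℝ) :
    0 ≤ ∑ i, ∑ j, ξ i * ξ j *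
      (inner ℝ (partialDeriv₂ v i j q) (v q - p) + inducedMetric v q i j) := by
  have h := second_variation_nonneg_of_isLocalMin hv hmin (WithLp.toLp 2 ξ)
  convert h using 1
  rw [← sum_smul_single ξ, ← real_inner_self_eq_norm_sq]
  simp only [map_sum, map_smul, sum_inner, inner_sum, _root_.sum_apply,
    _root_.smul_apply, partialDeriv₂_eq hv, real_inner_smul_left,
    real_inner_smul_right, inducedMetric, Matrix.of_apply, partialDeriv, mul_add,
    Finset.sum_add_distrib, mul_assoc]
  congr 1
  · rw [Finset.sum_comm]
    simp only [Finset.mul_sum]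
    refine Finset.sum_congr rfl fun i _ => Finset.sum_congr rfl fun j _ => by ring
  · refine Finset.sum_congr rfl fun i _ => Finset.sum_congr rfl fun j _ => by rw [real_inner_comm]

theorem inducedMetric_posDef (hinj : Function.Injective (fderiv ℝ v q)) :
    (inducedMetric v q).PosDef := by
  have hli : LinearIndependent ℝ fun i => partialDeriv v i q := by
    have := (EuclideanSpace.basisFun (Fin n) ℝ).toBasis.linearIndependent.map'
      (fderiv ℝ v q).toLinearMap (LinearMap.ker_eq_bot.mpr hinj)
    simpa [Function.comp_def, partialDeriv] using this
  exact Matrix.posDef_gram_of_linearIndependent hli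

/-- At the minimum `v q - p` is normal, so the projection in `H` drops out; the metric term of the
traced Hessian is `tr (g⁻¹g) = n`. -/
theorem neg_le_inner_coordMeanCurvature_of_isLocalMin (hv : ContDiffAt ℝ 2 v q)
    (hinj : Function.Injective (fderiv ℝ v q))
    (hmin : IsLocalMin (fun y => ‖v y - p‖ ^ 2) q) :
    -(n : ℝ) ≤ inner ℝ (coordMeanCurvature v q) (v q - p) := by
  have hg := inducedMetric_posDef hinj
  have h0 : ∀ k, inner ℝ (partialDeriv v k q) (v q - p) = 0 := fun k =>
    inner_fderiv_eq_zero_of_isLocalMin (hv.differentiableAt (by simp)) hmin _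
  have hH : inner ℝ (coordMeanCurvature v q) (v q - p) =
      ∑ i, ∑ j, (inducedMetric v q)⁻¹ i j * inner ℝ (partialDeriv₂ v i j q) (v q - p) := by
    simp only [coordMeanCurvature, normalProjection, sum_inner, real_inner_smul_left,
      inner_sub_left, h0, mul_zero, Finset.sum_const_zero, sub_zero]
  have htr : ∑ i, ∑ j, (inducedMetric v q)⁻¹ i j * inducedMetric v q i j = n := by
    have : ((inducedMetric v q)⁻¹ * inducedMetric v q).trace = n := by
      rw [Matrix.nonsing_inv_mul _ hg.det_pos.ne'.isUnit]
      simp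
    rw [← this]
    simp only [Matrix.trace, Matrix.diag, Matrix.mul_apply]
    refine Finset.sum_congr rfl fun i _ => Finset.sum_congr rfl fun j _ => ?_
    rw [← hg.isHermitian.apply i j, star_trivial]
  have := hg.inv.posSemidef.sum_mul_nonneg (hessian_nonneg_of_isLocalMin hv hmin)
  simp only [mul_add, Finset.sum_add_distrib, htr] at this
  rw [hH]
  linarith

end Coordinates

section Manifold

variable {n N : ℕ} {M : Type*} [TopologicalSpace M] [ChartedSpace (Euc n) M]

theorem neg_le_inner_meanCurvatureVector [IsManifold (𝓡 n) ∞ M] {f : M → Euc N} {x : M}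
    {p : Euc N} (hf : ContMDiff (𝓡 n) 𝓘(ℝ, Euc N) ∞ f)
    (hinj : Function.Injective (mfderiv (𝓡 n) 𝓘(ℝ, Euc N) f x))
    (hmin : ∀ y, ‖f x - p‖ ≤ ‖f y - p‖) :
    -(n : ℝ) ≤ inner ℝ (meanCurvatureVector n f x) (f x - p) := by
  have hfx : f x = (f ∘ (chartAt (Euc n) x).symm) (chartAt (Euc n) x x) := by simp
  have hv : ContDiffAt ℝ ∞ (f ∘ (chartAt (Euc n) x).symm) (chartAt (Euc n) x x) := by
    have := (contMDiffAt_iff.mp (hf x)).2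
    simp only [modelWithCornersSelf_coe, range_id, contDiffWithinAt_univ] at this
    exact this
  have hinj' : Function.Injective
      (fderiv ℝ (f ∘ (chartAt (Euc n) x).symm) (chartAt (Euc n) x x)) := by
    rw [((hf x).mdifferentiableAt (by simp)).mfderiv] at hinj
    simp only [modelWithCornersSelf_coe, range_id, fderivWithin_univ] at hinj
    exact hinj
  unfold meanCurvatureVector
  rw [hfx] at hmin ⊢
  -- Minimality over all of `M` covers every `y`, even outside the chart's target.
  refine neg_le_inner_coordMeanCurvature_of_isLocalMin (hv.of_le (by exact WithTop.coe_le_coe.mpr le_top))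
    hinj' (Eventually.of_forall fun y => ?_)
  exact pow_le_pow_left₀ (norm_nonneg _) (hmin _) 2

namespace IsMeanCurvatureFlow

variable {F₀ : M → Euc N} {J : Set ℝ} {F : ℝ → M → Euc N}

theorem contMDiff (hF : IsMeanCurvatureFlow n F₀ J F) {t : ℝ} (ht : t ∈ J) :
    ContMDiff (𝓡 n) 𝓘(ℝ, Euc N) ∞ (F t) := by
  rw [← contMDiffOn_univ]
  exact hF.smooth.comp (t := univ ×ˢ J) (f := fun x : M => (x, t))
    (contMDiff_id.prodMk contMDiff_const).contMDiffOn (fun x _ => ⟨mem_univ _, ht⟩)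

theorem exists_norm_sq_le [CompactSpace M] [IsManifold (𝓡 n) ∞ M] (hJ : J.OrdConnected)
    (h0 : IsLeast J 0) (hF : IsMeanCurvatureFlow n F₀ J F) {t : ℝ} (ht : t ∈ J) (x : M)
    (p : Euc N) : ∃ y, ‖F₀ y - p‖ ^ 2 ≤ ‖F t x - p‖ ^ 2 + 2 * n * t := by
  have hsub : Icc 0 t ⊆ J := hJ.out h0.1 ht
  have ht0 : 0 ≤ t := h0.2 ht
  obtain ⟨y, -, hy⟩ := isCompact_univ.exists_isMinOn (f := fun y => ‖F₀ y - p‖ ^ 2) ⟨x, mem_univ x⟩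
    (by
      rw [← hF.initial]
      exact ((hF.contMDiff h0.1).continuous.sub continuous_const).norm.pow 2 |>.continuousOn)
  refine ⟨y, le_of_forall_pos_le_add fun ε hε => ?_⟩
  -- The slope `2n + c` makes the time derivative at a spatial minimum at least `c > 0`.
  obtain ⟨c, hc, hct⟩ : ∃ c > 0, c * t ≤ ε := by
    refine ⟨ε / (t + 1), by positivity, ?_⟩
    rw [div_mul_eq_mul_div, div_le_iff₀ (by positivity)]
    nlinarith
  have hcont : ContinuousOn (fun z : M × ℝ => ‖F z.2 z.1 - p‖ ^ 2 + (2 * n + c) * z.2)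
      (univ ×ˢ Icc 0 t) := by
    have := hF.smooth.continuousOn.mono (prod_mono (Subset.refl univ) hsub)
    exact ((this.sub continuousOn_const).norm.pow 2).add
      (continuousOn_const.mul continuous_snd.continuousOn)
  obtain ⟨⟨z, s⟩, ⟨-, hs⟩, hmin⟩ := (isCompact_univ.prod isCompact_Icc).exists_isMinOn
    ⟨(x, t), mem_univ x, ht0, le_rfl⟩ hcont
  rw [isMinOn_iff] at hmin
  have hxt := hmin (x, t) ⟨mem_univ x, ht0, le_rfl⟩
  simp only at hxt
  have hs0 : s = 0 := by
    by_contra hne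
    have hspos : 0 < s := lt_of_le_of_ne hs.1 (Ne.symm hne)
    have hH := neg_le_inner_meanCurvatureVector (p := p) (hF.contMDiff (hsub hs))
      (hF.immersion s (hsub hs) z) (fun y => by
        have := hmin (y, s) ⟨mem_univ y, hs⟩
        simp only [add_le_add_iff_right] at this
        exact le_of_sq_le_sq this (norm_nonneg _))
    have hd := (((hF.evolution s (hsub hs) z).mono ((Icc_subset_Icc_right hs.2).trans hsub)
      |>.sub_const p).norm_sq).add (((hasDerivWithinAt_id s (Icc 0 s)).const_mul (2 * n + c)))
    have hm : IsLocalMinOn (fun r => ‖F r z - p‖ ^ 2 + (2 * n + c) * r) (Icc 0 s) s :=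
      eventually_nhdsWithin_of_forall fun r hr =>
        hmin (z, r) ⟨mem_univ z, hr.1, hr.2.trans hs.2⟩
    -- Only the past is used, so `s = t` is allowed: the derivative in direction `-s` must be
    -- nonnegative, yet it is at most `-s * c`.
    have := hm.hasFDerivWithinAt_nonneg hd.hasFDerivWithinAt (y := -s)
      (mem_posTangentConeAt_of_segment_subset (by
        rw [add_neg_cancel, segment_symm, segment_eq_Icc hspos.le]))
    simp at this
    rw [real_inner_comm] at hH
    nlinarith
  subst hs0
  have := hy (mem_univ z)
  rw [hF.initial] at hxt
  simp only [mem_ofPred_eq] at this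
  linarith

/-- With `p = F t x`, `‖F s x - p‖²` has zero derivative at `s = t`, so adding `2ns` gives slope `2n
> 0`. Some earlier `s` is strictly below `2nt`, and the weak bound applies from there. -/
theorem exists_norm_sq_lt [CompactSpace M] [IsManifold (𝓡 n) ∞ M] (hJ : J.OrdConnected)
    (h0 : IsLeast J 0) (hF : IsMeanCurvatureFlow n F₀ J F) (hn : 0 < n) {t : ℝ} (ht : t ∈ J)
    (htpos : 0 < t) (x : M) : ∃ y, ‖F₀ y - F t x‖ ^ 2 < 2 * n * t := by
  have hsub : Icc 0 t ⊆ J := hJ.out h0.1 ht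
  suffices h : ∃ s ∈ Icc 0 t, ‖F s x - F t x‖ ^ 2 + 2 * n * s < 2 * n * t by
    obtain ⟨s, hs, hlt⟩ := h
    obtain ⟨y, hy⟩ := hF.exists_norm_sq_le hJ h0 (hsub hs) x (F t x)
    exact ⟨y, hy.trans_lt hlt⟩
  by_contra! h
  have hd := (((hF.evolution t ht x).mono hsub
      |>.sub_const (F t x)).norm_sq).add (((hasDerivWithinAt_id t (Icc 0 t)).const_mul (2 * n : ℝ)))
  have hm : IsLocalMinOn (fun r => ‖F r x - F t x‖ ^ 2 + (2 * n : ℝ) * r) (Icc 0 t) t :=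
    eventually_nhdsWithin_of_forall fun r hr => by simpa using h r hr
  have := hm.hasFDerivWithinAt_nonneg hd.hasFDerivWithinAt (y := -t)
    (mem_posTangentConeAt_of_segment_subset (by
      rw [add_neg_cancel, segment_symm, segment_eq_Icc htpos.le]))
  simp at this
  have : (0 : ℝ) < n * t := by positivity
  linarith

end IsMeanCurvatureFlow

end Manifold

/-- `Metric.thickening δ S` is `{z | d(z, S) < δ}` and `Metric.cthickening δ S` is
`{z | d(z, S) ≤ δ}`. -/
theorem proposition2p1 {n m : ℕ} {M : Type*} [TopologicalSpace M] [T2Space M] [CompactSpace M]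
    [ChartedSpace (Euc n) M] [IsManifold (𝓡 n) ∞ M]
    (F₀ : M → Euc (n + m)) (J : Set ℝ) (hJ : J.OrdConnected) (h0 : IsLeast J 0)
    (F : ℝ → M → Euc (n + m)) (hF : IsMeanCurvatureFlow n F₀ J F) :
    (∀ t ∈ J, ∀ δ : ℝ, 0 ≤ δ → 2 * n * t ≤ δ ^ 2 →
      Metric.thickening (√(δ ^ 2 - 2 * n * t)) (Set.range (F t)) ⊆
        Metric.thickening δ (Set.range F₀)) ∧
    (∀ t ∈ J, Set.range (F t) ⊆ Metric.cthickening (√(2 * n * t)) (Set.range F₀)) ∧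
    (0 < n → ∀ t ∈ J, 0 < t →
      Set.range (F t) ⊆ Metric.thickening (√(2 * n * t)) (Set.range F₀)) := by
  refine ⟨fun t ht δ hδ _ z hz => ?_, fun t ht => ?_, fun hn t ht htpos => ?_⟩
  · obtain ⟨_, ⟨x, rfl⟩, hx⟩ := Metric.mem_thickening_iff.mp hz
    obtain ⟨y, hy⟩ := hF.exists_norm_sq_le hJ h0 ht x z
    rw [dist_comm, dist_eq_norm, Real.lt_sqrt (norm_nonneg _)] at hx
    refine Metric.mem_thickening_iff.mpr ⟨F₀ y, mem_range_self y, ?_⟩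
    rw [dist_comm, dist_eq_norm]
    exact lt_of_pow_lt_pow_left₀ 2 hδ (by linarith)
  · rintro _ ⟨x, rfl⟩
    obtain ⟨y, hy⟩ := hF.exists_norm_sq_le hJ h0 ht x (F t x)
    refine Metric.mem_cthickening_of_dist_le _ (F₀ y) _ _ (mem_range_self y) ?_
    rw [dist_comm, dist_eq_norm]
    exact Real.le_sqrt_of_sq_le (by simpa using hy)
  · rintro _ ⟨x, rfl⟩
    obtain ⟨y, hy⟩ := hF.exists_norm_sq_lt hJ h0 hn ht htpos x
    refine Metric.mem_thickening_iff.mpr ⟨F₀ y, mem_range_self y, ?_⟩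
    rw [dist_comm, dist_eq_norm]
    exact Real.lt_sqrt_of_sq_lt hy
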